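/- Let $\mathbf k$ be an algebraically closed field (of any characteristic) and let $G$ be a group of type $G_2$ or $F_4$ over $\mathbf k$, with Lie algebra $\mathfrak g$, given by Chevalley's construction. That is: let $R$ be a root system of type $G_2$ (resp. $F_4$) with simple roots $\alpha_1,\dots,\alpha_n$, and let $\mathfrak g_{\mathbb Z}$ be a Lie ring with a Chevalley basis $\{h_1,\dots,h_n\}\cup\{e_\alpha:\alpha\in R\}$, i.e. a $\mathbb Z$-basis with $[h_i,h_j]=0$, $[h_i,e_\alpha]=\langle\alpha,\alpha_i^\vee\rangle e_\alpha$, $[e_\alpha,e_{-\alpha}]=\sum_i c_ih_i$ where $\alpha^\vee=\sum_i c_i\alpha_i^\vee$, $[e_\alpha,e_\beta]=\pm(r+1)e_{\alpha+\beta}$ if $\alpha+\beta\in R$, where $r$ is the largest integer with $\beta-r\alpha\in R$, and $[e_\alpha,e_\beta]=0$ if $\alpha+\beta\notin R\cup\{0\}$. Put $\mathfrak g=\mathbf k\otimes_{\mathbb Z}\mathfrak g_{\mathbb Z}$, and let $G$ act on $\mathfrak g$ (adjoint action) as the group generated by all $x_\alpha(t)=\exp(t\operatorname{ad}e_\alpha)=\sum_{m}t^m\,(\operatorname{ad}e_\alpha)^m/m!$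 with $\alpha\in R$, $t\in\mathbf k$, where $(\operatorname{ad}e_\alpha)^m/m!$ is formed on $\mathfrak g_{\mathbb Z}$. Let $G$ act on the dual space $\mathfrak g^*$ by $(g.\xi)(x)=\xi(g^{-1}x)$. **Lemma 2.1.** Assume that $G$ is of type $G_2$ (resp. $F_4$). Then there exists a $G$-invariant non-degenerate bilinear form on $\mathfrak g$ if and only if $\operatorname{char}\mathbf k\neq 3$ (resp. $\operatorname{char}\mathbf k\neq2$). Moreover, if $\operatorname{char}\mathbf k\neq 3$ (resp. $\neq2$), then $\mathfrak g$ and $\mathfrak g^*$, together with the data from which their Springer correspondences $\gamma_{\mathfrak g}$ and $\gamma_{\mathfrak g^*}$ are constructed, can be identified $G$-equivariantly. Explicitly, let $\mathfrak n$ be the span of the $e_\alpha$ with $\alpha>0$, let $\mathfrak b$ be the span of $\mathfrak n$ and the $h_i$, and put $\mathfrak b^*=\{\xi\in\mathfrak g^*:\xi(\mathfrak n)=0\}$, $\mathfrak n^*=\{\xi\in\mathfrak g^*:\xi(\mathfrak b)=0\}$, $\mathcal N_{\mathfrak g}=\bigcup_{g\in G}g\,\mathfrak n$ and $\mathcal N_{\mathfrak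 g^*}=\{\xi\in\mathfrak g^*:\xi(g\,\mathfrak b)=0\text{ for some }g\in G\}$. Then there is a $G$-equivariant linear isomorphism $\kappa:\mathfrak g\to\mathfrak g^*$ with $\kappa(\mathfrak b)=\mathfrak b^*$, $\kappa(\mathfrak n)=\mathfrak n^*$ and $\kappa(\mathcal N_{\mathfrak g})=\mathcal N_{\mathfrak g^*}$. -/

import Mathlib

open scoped TensorProduct

noncomputable section

/-- The simple roots of the base `b` can be numbered so that the Cartan matrix of `b` is `A`. -/
def HasCartanType {ι M N : Type*} [AddCommGroup M] [Module ℚ M] [AddCommGroup N] [Module ℚ N]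
    {P : RootPairing ι ℚ M N} [P.IsCrystallographic] (b : P.Base)
    {n : ℕ} (A : Matrix (Fin n) (Fin n) ℤ) : Prop :=
  ∃ e : b.support ≃ Fin n, ∀ i j, b.cartanMatrix i j = A (e i) (e j)

/-- A Chevalley basis of a Lie ring `L`, with respect to a root system `P` with base `b`:
a `ℤ`-basis consisting of elements `h i` (one for each simple root) and `e α`
(one for each root) whose structure constants are those found by Chevalley. Thus `L` is the
Chevalley `ℤ`-form of the split simple Lie algebra with root system `P`. -/
structure ChevalleyBasis {ι M N : Type*} [Finite ι]
    [AddCommGroup M] [Module ℚ M] [AddCommGroup N] [Module ℚ N]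
    (P : RootPairing ι ℚ M N) [P.IsCrystallographic] (b : P.Base)
    (L : Type*) [LieRing L] where
  /-- The underlying `ℤ`-basis. -/
  basis : Module.Basis (b.support ⊕ ι) ℤ L
  lie_h_h (i j : b.support) : ⁅basis (.inl i), basis (.inl j)⁆ = 0
  lie_h_e (i : b.support) (α : ι) :
    ⁅basis (.inl i), basis (.inr α)⁆ = P.pairingIn ℤ α i • basis (.inr α)
  /-- `[e_α, e_{-α}]` is the coroot of `α`, written through the simple coroots. -/
  lie_e_neg (α β : ι) (c : b.support → ℤ) (hβ : P.root β = -P.root α)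
    (hc : P.coroot α = ∑ i, c i • P.coroot i) :
    ⁅basis (.inr α), basis (.inr β)⁆ = ∑ i, c i • basis (.inl i)
  /-- `[e_α, e_β] = ± (r + 1) e_{α + β}`, where `r` is the largest integer such that `β - r α`
  is a root. -/
  lie_e_e_of_add (α β γ : ι) (hγ : P.root γ = P.root α + P.root β) :
    ⁅basis (.inr α), basis (.inr β)⁆ = ((P.chainBotCoeff α β : ℤ) + 1) • basis (.inr γ) ∨
    ⁅basis (.inr α), basis (.inr β)⁆ = -((P.chainBotCoeff α β : ℤ) + 1) • basis (.inr γ)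
  lie_e_e_of_not_add (α β : ι) (h₀ : P.root α + P.root β ≠ 0)
    (h : P.root α + P.root β ∉ Set.range P.root) :
    ⁅basis (.inr α), basis (.inr β)⁆ = 0

namespace ChevalleyBasis

variable {ι M N : Type*} [Finite ι]
  [AddCommGroup M] [Module ℚ M] [AddCommGroup N] [Module ℚ N]
  {P : RootPairing ι ℚ M N} [P.IsCrystallographic] {b : P.Base}
  {L : Type*} [LieRing L] (C : ChevalleyBasis P b L)
  (k : Type*) [Field k]

/-- The Lie algebra `𝔤 = k ⊗ L` over `k`. -/
abbrev LieAlg (_C : ChevalleyBasis P b L) (k : Type*) [Field k] : Type _ := k ⊗[ℤ] L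

/-- The Cartan elements `h i` of `𝔤`. -/
def h (i : b.support) : C.LieAlg k := (1 : k) ⊗ₜ[ℤ] C.basis (.inl i)

/-- The root vectors `e α` of `𝔤`. -/
def e (α : ι) : C.LieAlg k := (1 : k) ⊗ₜ[ℤ] C.basis (.inr α)

/-- `φ = Ad (x_α(t))`, that is, `φ = exp (t ad e_α) = ∑ n, t ^ n ⊗ (ad e_α) ^ n / n!`. The divided
powers `D n = (ad e_α) ^ n / n!` are the endomorphisms of the free abelian group `L` with
`n! • D n = (ad e_α) ^ n`; they vanish for `4 ≤ n`, since root strings have at most four elements,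
so that the sum stops at `n = 3`. -/
def IsRootElement (α : ι) (t : k) (φ : C.LieAlg k ≃ₗ[k] C.LieAlg k) : Prop :=
  ∃ D : ℕ → Module.End ℤ L,
    (∀ n, (n.factorial : ℤ) • D n = LieAlgebra.ad ℤ L (C.basis (.inr α)) ^ n) ∧
    φ.toLinearMap = ∑ n ∈ Finset.range 4, t ^ n • (D n).baseChange k

/-- The Chevalley group `G` over `k`, in its adjoint action on `𝔤`: the group generated by all
`x_α(t)`, for `α` a root and `t` in `k`. -/
def group : Subgroup (C.LieAlg k ≃ₗ[k] C.LieAlg k) :=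
  Subgroup.closure {φ | ∃ α t, C.IsRootElement k α t φ}

/-- The coadjoint action, `(g.ξ)(x) = ξ(g⁻¹ x)`. -/
def coadj (g : C.LieAlg k ≃ₗ[k] C.LieAlg k) (ξ : Module.Dual k (C.LieAlg k)) :
    Module.Dual k (C.LieAlg k) :=
  ξ ∘ₗ (g⁻¹ : C.LieAlg k ≃ₗ[k] C.LieAlg k).toLinearMap

/-- `G`-invariance of a bilinear form on `𝔤`. -/
def IsInvariant (B : LinearMap.BilinForm k (C.LieAlg k)) : Prop :=
  ∀ g ∈ C.group k, ∀ x y, B (g x) (g y) = B x y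

/-- `G`-equivariance of a linear isomorphism from `𝔤` to `𝔤*`. -/
def IsEquivariant (κ : C.LieAlg k ≃ₗ[k] Module.Dual k (C.LieAlg k)) : Prop :=
  ∀ g ∈ C.group k, ∀ x, κ (g x) = C.coadj k g (κ x)

/-- `𝔫`, the Lie algebra of the unipotent radical of the Borel subgroup given by `b`. -/
def nilradical : Submodule k (C.LieAlg k) :=
  Submodule.span k {x | ∃ α, b.IsPos α ∧ x = C.e k α}

/-- `𝔟`, the Lie algebra of the Borel subgroup given by `b`. -/
def borel : Submodule k (C.LieAlg k) :=
  Submodule.span k (Set.range (C.h k)) ⊔ C.nilradical k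

/-- `𝔫* = {ξ | ξ(𝔟) = 0}`. -/
def nilradicalDual : Submodule k (Module.Dual k (C.LieAlg k)) :=
  (C.borel k).dualAnnihilator

/-- `𝔟* = {ξ | ξ(𝔫) = 0}`. -/
def borelDual : Submodule k (Module.Dual k (C.LieAlg k)) :=
  (C.nilradical k).dualAnnihilator

/-- The nilpotent elements of `𝔤`: those in the nilradical `g 𝔫` of some Borel subalgebra `g 𝔟`,
where `g` is in `G`. -/
def nilpotentCone : Set (C.LieAlg k) :=
  {x | ∃ g ∈ C.group k, ∃ y ∈ C.nilradical k, x = g y}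

/-- The nilpotent elements of `𝔤*`: those that annihilate some Borel subalgebra `g 𝔟`, where `g`
is in `G`. -/
def nilpotentConeDual : Set (Module.Dual k (C.LieAlg k)) :=
  {ξ | ∃ g ∈ C.group k, ∀ y ∈ C.borel k, ξ (g y) = 0}

/-- `κ` is a `G`-equivariant isomorphism from `𝔤` to `𝔤*` that carries the data from which the
Springer correspondence of `𝔤` is constructed, that is, `𝔟`, `𝔫` and the nilpotent cone, to the
data from which that of `𝔤*` is constructed. -/
structure IdentifiesSpringerData (κ : C.LieAlg k ≃ₗ[k] Module.Dual k (C.LieAlg k)) : Prop where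
  equivariant : C.IsEquivariant k κ
  map_borel : (C.borel k).map κ.toLinearMap = C.borelDual k
  map_nilradical : (C.nilradical k).map κ.toLinearMap = C.nilradicalDual k
  image_nilpotentCone : κ '' C.nilpotentCone k = C.nilpotentConeDual k

end ChevalleyBasis

end

set_option linter.unusedSectionVars false
set_option linter.unnecessarySeqFocus false

/-! Let p be the ratio of the squared root lengths: 3 for G₂, 2 for F₄.

Existence away from p: the Killing form over ℤ may vanish modulo primes other than p, so it is first
divided by a constant. Its values d_i on (e_i, e_{-i}) symmetrize the Cartan matrix, hence d_i is
d_l (l long) or p·d_l. Weyl invariance extends this to all roots, and d_l divides every value of the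
form. The quotient pairs e_α with e_{-α} to 1 or p, and on the h_i it is the Cartan matrix, of
determinant 1, with rows scaled by 1 or p (`exists_isNormalizedForm`). So it is non-degenerate as
soon as p ≠ 0 in k. It is G-invariant because skewness of ad e_α passes to the divided powers over
ℤ, where n! can be cancelled (`isInvariant_baseChange`). For this form 𝔟 and 𝔫 are each other's
orthogonal complements, so x ↦ B(x, ·) matches the Springer data.

Non-existence at p: k is infinite, so a G-invariant form is invariant under each ad e_α. For
adjacent simple roots l long and s short, ⟨α_l, α_s^∨⟩ = -p = 0 in k, and this forces h_s into the
radical (`not_nondegenerate_of_isInvariant`). Here G must really contain every x_α(t), whence the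
integrality of the divided powers (`exists_divided_powers`). -/

open RootPairing

/-! ### Integrality and nilpotency of the divided powers of `ad e_α`. -/

namespace ChevalleyBasis

variable {ι M N : Type*} [Finite ι]
  [AddCommGroup M] [Module ℚ M] [AddCommGroup N] [Module ℚ N]
  {P : RootPairing ι ℚ M N} [P.IsCrystallographic] {b : P.Base}
  {L : Type*} [LieRing L] (C : ChevalleyBasis P b L)

/-- The coroot of `α` as an element `[e_α, e_{-α}]` of `L`. -/
noncomputable def corootElt (α : ι) : L :=
  ⁅C.basis (.inr α), C.basis (.inr (P.reflectionPerm α α))⁆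

lemma root_reflectionPerm_self (α : ι) : P.root (P.reflectionPerm α α) = -P.root α := by
  rw [P.root_reflectionPerm, P.reflection_apply_self]

lemma pairingIn_eq_sum (α β : ι) (c : b.support → ℤ) (hc : P.coroot α = ∑ i, c i • P.coroot i) :
    P.pairingIn ℤ β α = ∑ i, c i * P.pairingIn ℤ β i := by
  apply (algebraMap ℤ ℚ).injective_int
  rw [P.algebraMap_pairingIn, ← P.root_coroot_eq_pairing, hc]
  simp only [map_sum, map_zsmul, P.root_coroot_eq_pairing, map_mul, P.algebraMap_pairingIn]
  simp

lemma exists_coroot_eq_sum (b : P.Base) (α : ι) :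
    ∃ c : b.support → ℤ, P.coroot α = ∑ i, c i • P.coroot i := by
  obtain ⟨f, -, -, hf⟩ := b.flip.exists_root_eq_sum_int α
  refine ⟨fun i ↦ f i, ?_⟩
  have : P.coroot α = ∑ j ∈ b.support, f j • P.coroot j := hf
  rw [this]
  exact (Finset.sum_coe_sort b.support (fun i ↦ f i • P.coroot i)).symm

lemma corootElt_simple (i : b.support) : C.corootElt i = C.basis (.inl i) := by
  classical
  rw [corootElt, C.lie_e_neg i _ (Pi.single i 1) (root_reflectionPerm_self _)]
  · rw [Finset.sum_eq_single i] <;> simp +contextual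
  · rw [Finset.sum_eq_single i] <;> simp +contextual

/-- The weight of a basis element with respect to `corootElt α`. -/
noncomputable def wt (b : P.Base) (α : ι) : b.support ⊕ ι → ℤ :=
  Sum.elim 0 (fun β ↦ P.pairingIn ℤ β α)

@[simp] lemma wt_inl (α : ι) (i : b.support) : wt b α (.inl i) = 0 := rfl

@[simp] lemma wt_inr (α β : ι) : wt b α (.inr β) = P.pairingIn ℤ β α := rfl

lemma lie_corootElt_basis (α : ι) (v : b.support ⊕ ι) :
    ⁅C.corootElt α, C.basis v⁆ = wt b α v • C.basis v := by
  obtain ⟨c, hc⟩ := exists_coroot_eq_sum b α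
  rw [corootElt, C.lie_e_neg α _ c (root_reflectionPerm_self _) hc, sum_lie]
  rcases v with j | β
  · simp [C.lie_h_h]
  · simp only [zsmul_lie, C.lie_h_e, wt_inr, pairingIn_eq_sum α β c hc, Finset.sum_smul, smul_smul]

lemma lie_e_h (α : ι) (i : b.support) :
    ⁅C.basis (.inr α), C.basis (.inl i)⁆ = -P.pairingIn ℤ α i • C.basis (.inr α) := by
  rw [← lie_skew, C.lie_h_e, neg_smul]

lemma isTorsionFree (C : ChevalleyBasis P b L) : Module.IsTorsionFree ℤ L := by
  have := Module.Free.of_basis C.basis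
  infer_instance

lemma repr_corootElt_lie (α : ι) (y : L) (v : b.support ⊕ ι) :
    C.basis.repr ⁅C.corootElt α, y⁆ v = wt b α v * C.basis.repr y v := by
  classical
  have : (Finsupp.lapply v ∘ₗ C.basis.repr.toLinearMap) ∘ₗ LieAlgebra.ad ℤ L (C.corootElt α) =
      wt b α v • (Finsupp.lapply v ∘ₗ C.basis.repr.toLinearMap) := by
    refine C.basis.ext fun w ↦ ?_
    simp only [LinearMap.comp_apply, LieAlgebra.ad_apply, lie_corootElt_basis]
    rcases eq_or_ne v w with rfl | h
    · simp
    · simp [h.symm]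
  simpa using LinearMap.congr_fun this y

lemma corootElt_lie_e (α : ι) :
    ⁅C.corootElt α, C.basis (.inr α)⁆ = (2 : ℤ) • C.basis (.inr α) := by
  simp [lie_corootElt_basis]

/-- By the Leibniz rule each application of `ad e_α` raises the weight by ⟨α, α^∨⟩ = 2. -/
lemma corootElt_lie_ad_pow (α : ι) (v : b.support ⊕ ι) (n : ℕ) :
    ⁅C.corootElt α, (LieAlgebra.ad ℤ L (C.basis (.inr α)) ^ n) (C.basis v)⁆ =
      (wt b α v + 2 * n) • (LieAlgebra.ad ℤ L (C.basis (.inr α)) ^ n) (C.basis v) := by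
  induction n with
  | zero => simp [lie_corootElt_basis]
  | succ n ih =>
    rw [pow_succ', Module.End.mul_apply, LieAlgebra.ad_apply, leibniz_lie, ih, corootElt_lie_e]
    simp only [zsmul_lie, lie_zsmul, ← add_smul]
    congr 1
    push_cast
    ring

variable [P.IsReduced]

lemma abs_wt_le (α : ι) (v : b.support ⊕ ι) : |wt b α v| ≤ 3 := by
  rcases v with i | β
  · simp
  · have := P.pairingIn_pairingIn_mem_set_of_isCrystal_of_isRed β α
    simp only [Set.mem_insert_iff, Set.mem_singleton_iff, Prod.mk.injEq] at this
    rw [wt_inr, abs_le]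
    omega

/-- Four steps raise the weight by 8, but any two weights differ by at most 6. -/
lemma ad_pow_four (α : ι) : LieAlgebra.ad ℤ L (C.basis (.inr α)) ^ 4 = 0 := by
  refine C.basis.ext fun v ↦ C.basis.ext_elem fun w ↦ ?_
  have h := C.repr_corootElt_lie α ((LieAlgebra.ad ℤ L (C.basis (.inr α)) ^ 4) (C.basis v)) w
  rw [corootElt_lie_ad_pow] at h
  have h1 := abs_le.mp (abs_wt_le α v)
  have h2 := abs_le.mp (abs_wt_le α w)
  simp only [map_smul, Finsupp.smul_apply, smul_eq_mul] at h
  have h3 : (wt b α v + 2 * (4 : ℕ) - wt b α w) *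
      C.basis.repr ((LieAlgebra.ad ℤ L (C.basis (.inr α)) ^ 4) (C.basis v)) w = 0 := by
    rw [sub_mul, h, sub_self]
  rcases mul_eq_zero.mp h3 with h4 | h4
  · omega
  · simpa using h4

/-- Moving up the α-string through β, the Chevalley constants ±(r + 1) have r growing by one at each
step, so with q = `P.chainBotCoeff α β` their product is ±(q + 1)⋯(q + n), a multiple of n!. -/
lemma ad_pow_e_of_linearIndependent (α β : ι)
    (hLI : LinearIndependent ℚ ![P.root α, P.root β]) (n : ℕ) :
    (LieAlgebra.ad ℤ L (C.basis (.inr α)) ^ n) (C.basis (.inr β)) = 0 ∨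
    ∃ γ, LinearIndependent ℚ ![P.root α, P.root γ] ∧
      P.chainBotCoeff α γ = P.chainBotCoeff α β + n ∧
      ∃ s : ℤ, (LieAlgebra.ad ℤ L (C.basis (.inr α)) ^ n) (C.basis (.inr β)) =
        (s * (P.chainBotCoeff α β + 1).ascFactorial n) • C.basis (.inr γ) := by
  induction n with
  | zero => exact .inr ⟨β, hLI, by simp, 1, by simp⟩
  | succ n ih =>
    rw [pow_succ', Module.End.mul_apply, LieAlgebra.ad_apply]
    obtain h0 | ⟨γ, hγ, hbot, s, hs⟩ := ih
    · exact .inl (by rw [h0, lie_zero])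
    rw [hs, lie_zsmul]
    have hne : P.root α + P.root γ ≠ 0 := by
      intro h
      exact ((IsReduced.linearIndependent_iff P).mp hγ).2 (eq_neg_of_add_eq_zero_left h)
    by_cases hr : P.root α + P.root γ ∈ Set.range P.root
    · obtain ⟨δ, hδ⟩ := hr
      have hδ' : P.root δ = P.root γ + P.root α := by rw [hδ, add_comm]
      refine .inr ⟨δ, ?_, ?_, ?_⟩
      · rw [hδ']
        rw [LinearIndependent.pair_iff] at hγ ⊢
        intro x y hxy
        have := hγ (x + y) y (by rw [← hxy]; module)
        refine ⟨by linarith, this.2⟩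
      · rw [chainBotCoeff_of_add hγ hδ', hbot, add_assoc]
      · have key (x : ℤ) : (x * (P.chainBotCoeff α β + 1).ascFactorial n) *
            ((P.chainBotCoeff α γ : ℤ) + 1) =
            x * (P.chainBotCoeff α β + 1).ascFactorial (n + 1) := by
          rw [Nat.ascFactorial_succ, hbot]; push_cast; ring
        rcases C.lie_e_e_of_add α γ δ hδ with h | h
        · exact ⟨s, by rw [h, smul_smul, key]⟩
        · refine ⟨-s, ?_⟩
          rw [h, smul_smul, mul_neg, key, neg_mul]
    · exact .inl (by rw [C.lie_e_e_of_not_add α γ hne hr, smul_zero])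

lemma exists_factorial_smul_eq_ad_pow_basis (α : ι) (n : ℕ) (v : b.support ⊕ ι) :
    ∃ y, (n.factorial : ℤ) • y = (LieAlgebra.ad ℤ L (C.basis (.inr α)) ^ n) (C.basis v) := by
  rcases le_or_gt 4 n with hn | hn
  · exact ⟨0, by rw [pow_eq_zero_of_le hn (C.ad_pow_four α)]; simp⟩
  -- This serves h_i, e_α and e_{-α}, which root strings do not cover: the second power of `ad e_α`
  -- gives 0, 0 and -2e_α.
  have low (v : L) (h2 : ∃ y, (2 : ℤ) • y = ⁅C.basis (.inr α), ⁅C.basis (.inr α), v⁆⁆)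
      (h3 : ⁅C.basis (.inr α), ⁅C.basis (.inr α), ⁅C.basis (.inr α), v⁆⁆⁆ = 0) :
      ∃ y, (n.factorial : ℤ) • y = (LieAlgebra.ad ℤ L (C.basis (.inr α)) ^ n) v := by
    interval_cases n
    · exact ⟨v, by simp⟩
    · exact ⟨⁅C.basis (.inr α), v⁆, by simp⟩
    · simpa [pow_succ] using h2
    · exact ⟨0, by simpa [pow_succ] using h3.symm⟩
  rcases v with i | β
  · apply low
    · exact ⟨0, by simp [lie_e_h]⟩
    · simp [lie_e_h]
  by_cases hLI : LinearIndependent ℚ ![P.root α, P.root β]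
  · obtain h | ⟨γ, -, -, s, h⟩ := C.ad_pow_e_of_linearIndependent α β hLI n
    · exact ⟨0, by rw [h, smul_zero]⟩
    · obtain ⟨q, hq⟩ := Nat.factorial_dvd_ascFactorial (P.chainBotCoeff α β + 1) n
      refine ⟨(s * q) • C.basis (.inr γ), ?_⟩
      rw [h, hq, smul_smul]
      push_cast
      congr 1
      ring
  · rw [IsReduced.linearIndependent_iff, not_and_or, not_not, not_not] at hLI
    rcases hLI with rfl | hneg
    · exact low _ ⟨0, by simp⟩ (by simp)
    · have hβ : β = P.reflectionPerm α α := by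
        apply P.root.injective
        rw [root_reflectionPerm_self, hneg, neg_neg]
      have h1 : ⁅C.basis (.inr α), C.basis (.inr β)⁆ = C.corootElt α := by rw [hβ, corootElt]
      have h2 : ⁅C.basis (.inr α), C.corootElt α⁆ = (2 : ℤ) • -C.basis (.inr α) := by
        rw [← lie_skew, corootElt_lie_e, smul_neg]
      exact low _ ⟨_, by rw [h1, h2]⟩ (by rw [h1, h2]; simp)

lemma exists_divided_powers (α : ι) : ∃ D : ℕ → Module.End ℤ L,
    ∀ n, (n.factorial : ℤ) • D n = LieAlgebra.ad ℤ L (C.basis (.inr α)) ^ n := by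
  choose y hy using C.exists_factorial_smul_eq_ad_pow_basis α
  refine ⟨fun n ↦ C.basis.constr ℤ (y n), fun n ↦ C.basis.ext fun v ↦ ?_⟩
  simp [← hy]

end ChevalleyBasis

/-! ### Exponentials of divided powers, and the invariance of base-changed forms. -/

namespace ChevalleyBasis

section DividedPowers

variable {A : Type*} [CommRing A] {V : Type*} [AddCommGroup V] [Module A V]

/-- The truncated exponential `1 + t d₁ + t² d₂ + t³ d₃` of a sequence of divided powers. -/
def expo (d : ℕ → Module.End A V) (t : A) : Module.End A V :=
  ∑ n ∈ Finset.range 4, t ^ n • d n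

lemma expo_eq (d : ℕ → Module.End A V) (h0 : d 0 = 1) (t : A) :
    expo d t = 1 + t • d 1 + t ^ 2 • d 2 + t ^ 3 • d 3 := by
  simp [expo, Finset.sum_range_succ, h0]

/-- In positive degree the alternating sums of binomial coefficients cancel; products of total
degree at least 4 vanish, so truncation does no harm. -/
lemma expo_mul_expo_neg (d : ℕ → Module.End A V) (h0 : d 0 = 1) (h4 : ∀ n, 4 ≤ n → d n = 0)
    (hd : ∀ i j, d i * d j = ((i + j).choose i : ℤ) • d (i + j)) (t : A) :
    expo d t * expo d (-t) = 1 := by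
  have h11 : d 1 * d 1 = (2 : A) • d 2 := by rw [hd]; norm_num [Nat.choose, ← Int.cast_smul_eq_zsmul A]
  have h12 : d 1 * d 2 = (3 : A) • d 3 := by rw [hd]; norm_num [Nat.choose, ← Int.cast_smul_eq_zsmul A]
  have h21 : d 2 * d 1 = (3 : A) • d 3 := by rw [hd]; norm_num [Nat.choose, ← Int.cast_smul_eq_zsmul A]
  have hz (i j : ℕ) (h : 4 ≤ i + j) : d i * d j = 0 := by rw [hd, h4 _ h, smul_zero]
  rw [expo_eq d h0, expo_eq d h0]
  simp only [mul_add, add_mul, mul_one, one_mul, smul_mul_smul_comm, h11, h12, h21,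
    hz 1 3 (by norm_num), hz 2 2 (by norm_num), hz 2 3 (by norm_num), hz 3 1 (by norm_num),
    hz 3 2 (by norm_num), hz 3 3 (by norm_num), smul_zero]
  module

/-- The linear automorphism given by the exponential of a sequence of divided powers. -/
def expoEquiv (d : ℕ → Module.End A V) (h0 : d 0 = 1) (h4 : ∀ n, 4 ≤ n → d n = 0)
    (hd : ∀ i j, d i * d j = ((i + j).choose i : ℤ) • d (i + j)) (t : A) : V ≃ₗ[A] V :=
  LinearEquiv.ofLinearMap (expo d t) (expo d (-t)) (expo_mul_expo_neg d h0 h4 hd t)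
    ((congrArg (expo d (-t) * expo d ·) (neg_neg t)).symm.trans (expo_mul_expo_neg d h0 h4 hd (-t)))

/-- The sign (-1)^n makes `expo d (-t)` the adjoint of `expo d t`, and it is also the inverse. -/
lemma bilin_expo (d : ℕ → Module.End A V) (h0 : d 0 = 1) (h4 : ∀ n, 4 ≤ n → d n = 0)
    (hd : ∀ i j, d i * d j = ((i + j).choose i : ℤ) • d (i + j)) (B : LinearMap.BilinForm A V)
    (hB : ∀ n x y, B (d n x) y = (-1) ^ n * B x (d n y)) (t : A) (x y : V) :
    B (expo d t x) (expo d t y) = B x y := by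
  have adj (x y : V) : B (expo d t x) y = B x (expo d (-t) y) := by
    simp only [expo, LinearMap.sum_apply, map_sum, LinearMap.smul_apply, map_smul, smul_eq_mul, hB]
    refine Finset.sum_congr rfl fun n _ ↦ ?_
    rw [neg_pow t]
    ring
  have := expo_mul_expo_neg d h0 h4 hd (-t)
  rw [neg_neg] at this
  rw [adj, ← Module.End.mul_apply, this, Module.End.one_apply]

end DividedPowers

variable {ι M N : Type*} [Finite ι]
  [AddCommGroup M] [Module ℚ M] [AddCommGroup N] [Module ℚ N]
  {P : RootPairing ι ℚ M N} [P.IsCrystallographic] {b : P.Base}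
  {L : Type*} [LieRing L] (C : ChevalleyBasis P b L) [P.IsReduced]
  {k : Type*} [Field k]

lemma eq_of_factorial_smul_eq (C : ChevalleyBasis P b L) {n : ℕ} {x y : Module.End ℤ L}
    (h : (n.factorial : ℤ) • x = (n.factorial : ℤ) • y) : x = y := by
  have := C.isTorsionFree
  exact smul_right_injective _ (by exact_mod_cast n.factorial_ne_zero) h

variable {α : ι} {D : ℕ → Module.End ℤ L}

lemma divided_power_zero (C : ChevalleyBasis P b L)
    (hD : ∀ n, (n.factorial : ℤ) • D n = LieAlgebra.ad ℤ L (C.basis (.inr α)) ^ n) : D 0 = 1 := by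
  simpa using hD 0

lemma divided_power_one (C : ChevalleyBasis P b L)
    (hD : ∀ n, (n.factorial : ℤ) • D n = LieAlgebra.ad ℤ L (C.basis (.inr α)) ^ n) :
    D 1 = LieAlgebra.ad ℤ L (C.basis (.inr α)) := by
  simpa using hD 1

lemma divided_power_eq_zero (C : ChevalleyBasis P b L)
    (hD : ∀ n, (n.factorial : ℤ) • D n = LieAlgebra.ad ℤ L (C.basis (.inr α)) ^ n) (n : ℕ)
    (hn : 4 ≤ n) : D n = 0 := by
  apply C.eq_of_factorial_smul_eq (n := n)
  rw [hD, pow_eq_zero_of_le hn (C.ad_pow_four α), smul_zero]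

/-- Both sides agree after multiplication by i!·j!, and `L` is torsion-free. -/
lemma divided_power_mul (C : ChevalleyBasis P b L)
    (hD : ∀ n, (n.factorial : ℤ) • D n = LieAlgebra.ad ℤ L (C.basis (.inr α)) ^ n) (i j : ℕ) :
    D i * D j = ((i + j).choose i : ℤ) • D (i + j) := by
  have := C.isTorsionFree
  have h0 : ((i.factorial : ℤ) * j.factorial) ≠ 0 := by positivity
  refine smul_right_injective _ h0 ?_
  have h1 : ((i.factorial : ℤ) * j.factorial) * ((i + j).choose i) = (i + j).factorial := by
    rw [← Nat.add_choose_mul_factorial_mul_factorial i j, Nat.choose_symm_add]; push_cast; ring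
  simp only [smul_smul, h1]
  rw [hD, pow_add, ← hD, ← hD, smul_mul_smul_comm]

variable (k) in
/-- The divided powers of `ad e_α` over `k`. -/
def baseChangePowers (D : ℕ → Module.End ℤ L) (n : ℕ) : Module.End k (k ⊗[ℤ] L) :=
  (D n).baseChange k

lemma baseChangePowers_zero (hD : D 0 = 1) : baseChangePowers k D 0 = 1 := by
  rw [baseChangePowers, hD, Module.End.one_eq_id, LinearMap.baseChange_id]; rfl

lemma baseChangePowers_eq_zero (hD : ∀ n, 4 ≤ n → D n = 0) (n : ℕ) (hn : 4 ≤ n) :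
    baseChangePowers k D n = 0 := by
  rw [baseChangePowers, hD n hn, LinearMap.baseChange_zero]

lemma baseChangePowers_mul (hD : ∀ i j, D i * D j = ((i + j).choose i : ℤ) • D (i + j)) (i j : ℕ) :
    baseChangePowers k D i * baseChangePowers k D j =
      ((i + j).choose i : ℤ) • baseChangePowers k D (i + j) := by
  have : (D i * D j).baseChange k = (((i + j).choose i : ℤ) • D (i + j)).baseChange k := by
    rw [hD]
  rw [LinearMap.baseChange_smul, Module.End.mul_eq_comp, LinearMap.baseChange_comp] at this
  exact this

variable (k) in
lemma exists_isRootElement (C : ChevalleyBasis P b L)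
    (hD : ∀ n, (n.factorial : ℤ) • D n = LieAlgebra.ad ℤ L (C.basis (.inr α)) ^ n) (t : k) :
    ∃ φ, C.IsRootElement k α t φ ∧ φ.toLinearMap = expo (baseChangePowers k D) t :=
  ⟨expoEquiv (baseChangePowers k D) (baseChangePowers_zero (C.divided_power_zero hD))
    (baseChangePowers_eq_zero (C.divided_power_eq_zero hD))
    (baseChangePowers_mul (C.divided_power_mul hD)) t, ⟨D, hD, rfl⟩, rfl⟩

lemma bilin_ad_pow (B : LinearMap.BilinForm ℤ L) (hB : ∀ x y z : L, B ⁅x, y⁆ z = -B y ⁅x, z⁆)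
    (x : L) (n : ℕ) (y z : L) :
    B ((LieAlgebra.ad ℤ L x ^ n) y) z = (-1) ^ n * B y ((LieAlgebra.ad ℤ L x ^ n) z) := by
  induction n generalizing z with
  | zero => simp
  | succ n ih =>
    rw [pow_succ', Module.End.mul_apply, LieAlgebra.ad_apply, hB, ih, ← LieAlgebra.ad_apply ℤ,
      ← Module.End.mul_apply, ← pow_succ, ← pow_succ', pow_succ (-1 : ℤ)]
    ring

/-- An invariant form on `L` induces a form on `𝔤` that is invariant under the Chevalley group. -/
lemma isInvariant_baseChange (B : LinearMap.BilinForm ℤ L)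
    (hB : ∀ x y z : L, B ⁅x, y⁆ z = -B y ⁅x, z⁆) :
    C.IsInvariant k (LinearMap.BilinForm.baseChange k B) := by
  intro g hg
  induction hg using Subgroup.closure_induction with
  | mem φ hφ =>
    obtain ⟨α, t, D, hD, hφ⟩ := hφ
    intro x y
    -- The factor n! is cancelled over ℤ, before base change; in `k` it may be zero.
    have key (n : ℕ) (x y : L) : B (D n x) y = (-1) ^ n * B x (D n y) := by
      have h0 : (n.factorial : ℤ) ≠ 0 := by positivity
      apply mul_left_cancel₀ h0
      have h1 := bilin_ad_pow B hB (C.basis (.inr α)) n x y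
      rw [← hD] at h1
      simp only [LinearMap.smul_apply, map_smul, smul_eq_mul] at h1
      rw [h1]; ring
    have hx (x) : φ x = expo (baseChangePowers k D) t x := LinearMap.congr_fun hφ x
    rw [hx, hx]
    refine bilin_expo _ (baseChangePowers_zero (C.divided_power_zero hD))
      (baseChangePowers_eq_zero (C.divided_power_eq_zero hD))
      (baseChangePowers_mul (C.divided_power_mul hD)) _ (fun n x y ↦ ?_) t x y
    induction x with
    | zero => simp
    | add x x' hx hx' => simp only [map_add, LinearMap.add_apply, hx, hx', mul_add]
    | tmul a x =>
      induction y with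
      | zero => simp
      | add y y' hy hy' => simp only [map_add, hy, hy', mul_add]
      | tmul c y =>
        simp only [baseChangePowers, LinearMap.baseChange_tmul, LinearMap.BilinForm.baseChange_tmul,
          key]
        simp only [← Int.cast_smul_eq_zsmul k]
        push_cast
        simp only [smul_eq_mul]
        ring
  | one => intro x y; rfl
  | mul g h _ _ hg hh => intro x y; rw [LinearEquiv.mul_apply, LinearEquiv.mul_apply, hg, hh]
  | inv g _ hg => intro x y; rw [← hg, ← LinearEquiv.mul_apply, ← LinearEquiv.mul_apply]; simp

end ChevalleyBasis

/-! ### No non-degenerate invariant form in the bad characteristic. -/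

namespace ChevalleyBasis

variable {ι M N : Type*} [Finite ι]
  [AddCommGroup M] [Module ℚ M] [AddCommGroup N] [Module ℚ N]
  {P : RootPairing ι ℚ M N} [P.IsCrystallographic] {b : P.Base}
  {L : Type*} [LieRing L] (C : ChevalleyBasis P b L) [P.IsReduced]
  {k : Type*} [Field k]

/-- If a bilinear form is invariant under the exponentials of a sequence of divided powers, then
it is infinitesimally invariant. -/
lemma bilin_infinitesimal [Infinite k] {V : Type*} [AddCommGroup V] [Module k V]
    (d : ℕ → Module.End k V) (h0 : d 0 = 1) (B : LinearMap.BilinForm k V) (x y : V)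
    (hB : ∀ t, B (expo d t x) (expo d t y) = B x y) :
    B (d 1 x) y + B x (d 1 y) = 0 := by
  let p : Polynomial k := ∑ i ∈ Finset.range 4, ∑ j ∈ Finset.range 4,
    Polynomial.C (B (d i x) (d j y)) * Polynomial.X ^ (i + j)
  -- As a polynomial in t, B(exp(t)x, exp(t)y) takes a constant value on an infinite field, so its
  -- coefficient of t is zero.
  have hp : p = Polynomial.C (B x y) := by
    refine Polynomial.funext fun t ↦ ?_
    rw [Polynomial.eval_C, ← hB t]
    simp only [p, expo, Polynomial.eval_finsetSum, Polynomial.eval_mul, Polynomial.eval_C,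
      Polynomial.eval_pow, Polynomial.eval_X, LinearMap.sum_apply, map_sum, LinearMap.smul_apply,
      map_smul, smul_eq_mul]
    rw [Finset.sum_comm]
    refine Finset.sum_congr rfl fun i _ ↦ ?_
    rw [Finset.mul_sum]
    exact Finset.sum_congr rfl fun j _ ↦ by ring
  have h1 : p.coeff 1 = B x (d 1 y) + B (d 1 x) y := by
    simp [p, Finset.sum_range_succ, h0, Polynomial.coeff_X_pow]
  rw [add_comm, ← h1, hp, Polynomial.coeff_C_succ]

lemma bilin_lie_e [Infinite k] {B : LinearMap.BilinForm k (C.LieAlg k)} (hB : C.IsInvariant k B)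
    (α : ι) (x y : L) :
    B (1 ⊗ₜ ⁅C.basis (.inr α), x⁆) (1 ⊗ₜ y) = -B (1 ⊗ₜ x) (1 ⊗ₜ ⁅C.basis (.inr α), y⁆) := by
  obtain ⟨D, hD⟩ := C.exists_divided_powers α
  have := bilin_infinitesimal (baseChangePowers k D)
    (baseChangePowers_zero (C.divided_power_zero hD)) B (1 ⊗ₜ x) (1 ⊗ₜ y) fun t ↦ by
      obtain ⟨φ, hφ, h⟩ := C.exists_isRootElement k hD t
      rw [← h]
      exact hB φ (Subgroup.subset_closure ⟨α, t, hφ⟩) _ _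
  simp only [baseChangePowers, C.divided_power_one hD, LinearMap.baseChange_tmul,
    LieAlgebra.ad_apply] at this
  exact eq_neg_of_add_eq_zero_left this

/-- Operators skew for `B` are closed under commutators, and `corootElt α` is [e_α, e_{-α}]. -/
lemma bilin_lie_corootElt [Infinite k] {B : LinearMap.BilinForm k (C.LieAlg k)}
    (hB : C.IsInvariant k B) (α : ι) (x y : L) :
    B (1 ⊗ₜ ⁅C.corootElt α, x⁆) (1 ⊗ₜ y) = -B (1 ⊗ₜ x) (1 ⊗ₜ ⁅C.corootElt α, y⁆) := by
  simp only [corootElt, lie_lie, TensorProduct.tmul_sub, map_sub, LinearMap.sub_apply,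
    C.bilin_lie_e hB]
  ring

/-- Every root pairs non-trivially, modulo the characteristic, with some coroot. -/
lemma exists_pairingIn_ne_zero (hsimple : ∀ i : b.support, ∃ j : b.support,
    (b.cartanMatrix i j : k) ≠ 0) (β : ι) : ∃ γ, (P.pairingIn ℤ β γ : k) ≠ 0 := by
  refine b.induction_reflect β (p := fun β ↦ ∃ γ, (P.pairingIn ℤ β γ : k) ≠ 0) ?_ ?_ ?_
  · rintro i ⟨γ, hγ⟩
    exact ⟨γ, by simpa using hγ⟩
  · intro i hi
    obtain ⟨j, hj⟩ := hsimple ⟨i, hi⟩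
    exact ⟨j, by simpa [Base.cartanMatrixIn_def] using hj⟩
  · rintro i j ⟨γ, hγ⟩ -
    refine ⟨P.reflectionPerm j γ, ?_⟩
    rwa [P.pairingIn_reflectionPerm, P.reflectionPerm_self]

lemma tmul_zsmul_eq (n : ℤ) (x : L) : (1 : k) ⊗ₜ[ℤ] (n • x) = (n : k) • ((1 : k) ⊗ₜ[ℤ] x) := by
  rw [TensorProduct.tmul_smul, Int.cast_smul_eq_zsmul]

/-- If the simple root `l` is longer than the simple root `s`, and the ratio of their squared
lengths is the characteristic, then there is no non-degenerate invariant form. -/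
theorem not_nondegenerate_of_isInvariant [Infinite k] (l s : b.support)
    (hls : (b.cartanMatrix l s : k) = 0) (hsl : (b.cartanMatrix s l : k) ≠ 0)
    (hsimple : ∀ i : b.support, ∃ j : b.support, (b.cartanMatrix i j : k) ≠ 0)
    {B : LinearMap.BilinForm k (C.LieAlg k)} (hB : C.IsInvariant k B) : ¬ B.Nondegenerate := by
  intro hnd
  have hh (i j : b.support) : B (1 ⊗ₜ C.basis (.inl i)) (1 ⊗ₜ C.basis (.inl j)) =
      b.cartanMatrix i j * B (1 ⊗ₜ C.basis (.inr (P.reflectionPerm i i)))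
        (1 ⊗ₜ C.basis (.inr i)) := by
    rw [← corootElt_simple C i, corootElt, bilin_lie_e C hB, lie_e_h, tmul_zsmul_eq, map_smul,
      ← Base.cartanMatrixIn_def ℤ b i j, Int.cast_neg, neg_smul, neg_neg, smul_eq_mul]
  -- B(h_s, h_l) is computed twice: moving e_l across gives the factor ⟨α_l, α_s^∨⟩ = 0, while `hh`
  -- gives ⟨α_s, α_l^∨⟩ ≠ 0 times the value in question.
  have hs0 : B (1 ⊗ₜ C.basis (.inr (P.reflectionPerm s s))) (1 ⊗ₜ C.basis (.inr s)) = 0 := by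
    have h1 : B (1 ⊗ₜ C.basis (.inl s)) (1 ⊗ₜ C.basis (.inl l)) = 0 := by
      have h2 := C.bilin_lie_e hB l (C.basis (.inl s)) (C.basis (.inr (P.reflectionPerm l l)))
      rw [← corootElt, corootElt_simple, lie_e_h, tmul_zsmul_eq, map_smul, LinearMap.smul_apply,
        ← Base.cartanMatrixIn_def ℤ b l s, Int.cast_neg, hls, neg_zero, zero_smul] at h2
      exact neg_eq_zero.mp h2.symm
    rw [hh] at h1
    exact (mul_eq_zero.mp h1).resolve_left hsl
  have hrad : B (1 ⊗ₜ C.basis (.inl s)) = 0 := by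
    refine (C.basis.baseChange k).ext fun v ↦ ?_
    rw [Module.Basis.baseChange_apply, LinearMap.zero_apply]
    rcases v with j | β
    · rw [hh, hs0, mul_zero]
    -- h_s has weight 0, so it is orthogonal to e_β once some coroot gives β a weight that is
    -- non-zero in `k`.
    · obtain ⟨γ, hγ⟩ := exists_pairingIn_ne_zero hsimple β
      have h2 := C.bilin_lie_corootElt hB γ (C.basis (.inl s)) (C.basis (.inr β))
      simp only [lie_corootElt_basis, wt_inr, wt_inl, zero_smul, TensorProduct.tmul_zero, map_zero,
        LinearMap.zero_apply, tmul_zsmul_eq, map_smul, smul_eq_mul, zero_eq_neg, mul_eq_zero] at h2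
      exact h2.resolve_left hγ
  have hzero : (C.basis.baseChange k) (.inl s) = 0 := by
    rw [Module.Basis.baseChange_apply]
    exact hnd.1 _ fun y ↦ by rw [hrad, LinearMap.zero_apply]
  exact (C.basis.baseChange k).ne_zero _ hzero

end ChevalleyBasis

/-! ### The Killing form over ℤ on the Chevalley basis. -/

namespace ChevalleyBasis

variable {ι M N : Type*} [Finite ι]
  [AddCommGroup M] [Module ℚ M] [AddCommGroup N] [Module ℚ N]
  {P : RootPairing ι ℚ M N} [P.IsCrystallographic] {b : P.Base}
  {L : Type*} [LieRing L] (C : ChevalleyBasis P b L) [P.IsReduced]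
  {k : Type*} [Field k]

lemma traceForm_lie (x y z : L) :
    LieModule.traceForm ℤ L L ⁅x, y⁆ z = -LieModule.traceForm ℤ L L y ⁅x, z⁆ := by
  rw [← lie_skew, map_neg, LinearMap.neg_apply, LieModule.traceForm_apply_lie_apply]

lemma traceForm_corootElt [Fintype ι] (α β : ι) :
    LieModule.traceForm ℤ L L (C.corootElt α) (C.corootElt β) =
      ∑ γ, P.pairingIn ℤ γ α * P.pairingIn ℤ γ β := by
  classical
  rw [LieModule.traceForm_apply_apply, LinearMap.trace_eq_matrix_trace ℤ C.basis, Matrix.trace,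
    Fintype.sum_sum_type]
  simp [LinearMap.toMatrix_apply, lie_corootElt_basis, mul_comm]

lemma two_mul_traceForm_e (α : ι) :
    2 * LieModule.traceForm ℤ L L (C.basis (.inr α)) (C.basis (.inr (P.reflectionPerm α α))) =
      LieModule.traceForm ℤ L L (C.corootElt α) (C.corootElt α) := by
  conv_rhs => rw [corootElt, LieModule.traceForm_apply_lie_apply, ← corootElt, ← lie_skew,
    lie_corootElt_basis]
  simp

/-- Together with the symmetry of the trace form, this shows that the values on (e_i, e_{-i})
symmetrize the Cartan matrix. -/
lemma traceForm_h_h (i j : b.support) :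
    LieModule.traceForm ℤ L L (C.basis (.inl i)) (C.basis (.inl j)) = b.cartanMatrix i j *
      LieModule.traceForm ℤ L L (C.basis (.inr i)) (C.basis (.inr (P.reflectionPerm i i))) := by
  rw [← corootElt_simple C i, corootElt, LieModule.traceForm_apply_lie_apply, ← lie_skew,
    C.lie_h_e, P.pairingIn_reflectionPerm_self_left, neg_smul, neg_neg, map_smul, smul_eq_mul,
    ← Base.cartanMatrixIn_def ℤ b i j]

lemma traceForm_basis_eq_zero (v w : b.support ⊕ ι) (α : ι) (h : wt b α v + wt b α w ≠ 0) :
    LieModule.traceForm ℤ L L (C.basis v) (C.basis w) = 0 := by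
  have := traceForm_lie (C.corootElt α) (C.basis v) (C.basis w)
  rw [lie_corootElt_basis, lie_corootElt_basis] at this
  simp only [map_smul, LinearMap.smul_apply, smul_eq_mul] at this
  have h2 : (wt b α v + wt b α w) * LieModule.traceForm ℤ L L (C.basis v) (C.basis w) = 0 := by
    rw [add_mul, this]; ring
  exact (mul_eq_zero.mp h2).resolve_left h

/-- Coroots span, so they detect α + β ≠ 0. This makes e_α and e_β orthogonal unless the roots are
opposite. -/
lemma exists_pairingIn_add_ne_zero [P.IsRootSystem] {α β : ι} (h : P.root β ≠ -P.root α) :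
    ∃ γ, P.pairingIn ℤ α γ + P.pairingIn ℤ β γ ≠ 0 := by
  by_contra! hc
  apply h
  rw [eq_neg_iff_add_eq_zero]
  apply (LinearMap.IsPerfPair.bijective_left P.toLinearMap).1
  rw [map_zero, add_comm]
  refine LinearMap.ext_on (s := Set.range P.coroot) IsRootSystem.span_coroot_eq_top ?_
  rintro - ⟨γ, rfl⟩
  have := congrArg (algebraMap ℤ ℚ) (hc γ)
  rw [map_add, P.algebraMap_pairingIn, P.algebraMap_pairingIn, map_zero] at this
  simpa using this

end ChevalleyBasis

/-! ### Dividing the Killing form by its value at a long root. -/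

namespace ChevalleyBasis

variable {ι M N : Type*} [Finite ι]
  [AddCommGroup M] [Module ℚ M] [AddCommGroup N] [Module ℚ N]
  {P : RootPairing ι ℚ M N} [P.IsCrystallographic] {b : P.Base}
  {L : Type*} [LieRing L] (C : ChevalleyBasis P b L) [P.IsReduced]
  {k : Type*} [Field k]

/-- A reflection only permutes the terms of the sum over all roots. -/
lemma traceForm_corootElt_reflectionPerm (α β : ι) :
    LieModule.traceForm ℤ L L (C.corootElt (P.reflectionPerm α β))
      (C.corootElt (P.reflectionPerm α β)) =
    LieModule.traceForm ℤ L L (C.corootElt β) (C.corootElt β) := by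
  have := Fintype.ofFinite ι
  simp only [traceForm_corootElt, P.pairingIn_reflectionPerm]
  exact Equiv.sum_comp (P.reflectionPerm α) fun γ ↦ P.pairingIn ℤ γ β * P.pairingIn ℤ γ β

lemma exists_traceForm_e_eq_simple (α : ι) : ∃ i : b.support,
    LieModule.traceForm ℤ L L (C.basis (.inr α)) (C.basis (.inr (P.reflectionPerm α α))) =
      LieModule.traceForm ℤ L L (C.basis (.inr i)) (C.basis (.inr (P.reflectionPerm i i))) := by
  suffices ∃ i : b.support, LieModule.traceForm ℤ L L (C.corootElt α) (C.corootElt α) =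
      LieModule.traceForm ℤ L L (C.corootElt i) (C.corootElt i) by
    obtain ⟨i, hi⟩ := this
    rw [← two_mul_traceForm_e, ← two_mul_traceForm_e] at hi
    exact ⟨i, by omega⟩
  refine b.induction_reflect α (p := fun α ↦ ∃ i : b.support,
    LieModule.traceForm ℤ L L (C.corootElt α) (C.corootElt α) =
      LieModule.traceForm ℤ L L (C.corootElt i) (C.corootElt i)) ?_ (fun i hi ↦ ⟨⟨i, hi⟩, rfl⟩) ?_
  · rintro i ⟨j, hj⟩
    exact ⟨j, by rw [traceForm_corootElt_reflectionPerm, hj]⟩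
  · rintro i j ⟨l, hl⟩ -
    exact ⟨l, by rw [traceForm_corootElt_reflectionPerm, hl]⟩

/-- Twice this value is the sum over γ of ⟨γ, α^∨⟩², whose term at γ = α is 4. -/
lemma traceForm_e_ne_zero (α : ι) : LieModule.traceForm ℤ L L (C.basis (.inr α))
    (C.basis (.inr (P.reflectionPerm α α))) ≠ 0 := by
  have := Fintype.ofFinite ι
  intro h
  have h2 := C.two_mul_traceForm_e α
  rw [h, mul_zero, traceForm_corootElt, eq_comm,
    Finset.sum_eq_zero_iff_of_nonneg fun _ _ ↦ mul_self_nonneg _] at h2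
  simpa using h2 α (Finset.mem_univ α)

/-- A normalized invariant form on `L`, where `c i` is the value on `(e_i, e_{-i})`. -/
structure IsNormalizedForm (c : b.support → ℤ) (B : LinearMap.BilinForm ℤ L) : Prop where
  lie_left (x y z : L) : B ⁅x, y⁆ z = -B y ⁅x, z⁆
  h_h (i j : b.support) : B (C.basis (.inl i)) (C.basis (.inl j)) = b.cartanMatrix i j * c i
  h_e (i : b.support) (β : ι) : B (C.basis (.inl i)) (C.basis (.inr β)) = 0
  e_h (i : b.support) (β : ι) : B (C.basis (.inr β)) (C.basis (.inl i)) = 0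
  e_neg (α : ι) : ∃ i, B (C.basis (.inr α)) (C.basis (.inr (P.reflectionPerm α α))) = c i
  e_e (α β : ι) (h : β ≠ P.reflectionPerm α α) : B (C.basis (.inr α)) (C.basis (.inr β)) = 0

/-- The Killing form is a multiple of a normalized form, if the relative root lengths are determined
by the symmetrizability of the Cartan matrix. -/
theorem exists_isNormalizedForm [P.IsRootSystem] (c : b.support → ℤ) (i₀ : b.support)
    (hc : ∀ d : b.support → ℤ, (∀ i j, b.cartanMatrix i j * d i = b.cartanMatrix j i * d j) →
      ∀ i, d i = c i * d i₀) : ∃ B, C.IsNormalizedForm c B := by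
  classical
  have := C.isTorsionFree
  let K := LieModule.traceForm ℤ L L
  let d (i : b.support) : ℤ := K (C.basis (.inr i)) (C.basis (.inr (P.reflectionPerm i i)))
  have hd (i) : d i = c i * d i₀ := hc d (fun i j ↦ by
    rw [← traceForm_h_h, ← traceForm_h_h, LieModule.traceForm_comm]) i
  have hm : d i₀ ≠ 0 := C.traceForm_e_ne_zero _
  have hhh (i j) : K (C.basis (.inl i)) (C.basis (.inl j)) = d i₀ * (b.cartanMatrix i j * c i) := by
    rw [C.traceForm_h_h i j]
    change _ * d i = _
    rw [hd]
    ring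
  have hhe (i β) : K (C.basis (.inl i)) (C.basis (.inr β)) = 0 :=
    C.traceForm_basis_eq_zero _ _ β (by simp)
  have heh (i β) : K (C.basis (.inr β)) (C.basis (.inl i)) = 0 :=
    C.traceForm_basis_eq_zero _ _ β (by simp)
  have hneg (α) : ∃ i, K (C.basis (.inr α)) (C.basis (.inr (P.reflectionPerm α α))) =
      d i₀ * c i := by
    obtain ⟨i, hi⟩ := C.exists_traceForm_e_eq_simple α
    exact ⟨i, hi.trans ((hd i).trans (mul_comm _ _))⟩
  have hee (α β) (h : β ≠ P.reflectionPerm α α) : K (C.basis (.inr α)) (C.basis (.inr β)) = 0 := by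
    obtain ⟨γ, hγ⟩ := exists_pairingIn_add_ne_zero (P := P) (α := α) (β := β) fun hβ ↦
      h (P.root.injective (by rw [hβ, root_reflectionPerm_self]))
    exact C.traceForm_basis_eq_zero _ _ γ hγ
  have hdvd (v w) : ∃ q, K (C.basis v) (C.basis w) = d i₀ * q := by
    rcases v with i | α <;> rcases w with j | β
    · exact ⟨_, hhh i j⟩
    · exact ⟨0, by rw [hhe, mul_zero]⟩
    · exact ⟨0, by rw [heh, mul_zero]⟩
    · rcases eq_or_ne β (P.reflectionPerm α α) with rfl | h
      · exact ⟨_, (hneg α).choose_spec⟩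
      · exact ⟨0, by rw [hee α β h, mul_zero]⟩
  choose q hq using hdvd
  let B : LinearMap.BilinForm ℤ L := C.basis.constr ℤ fun v ↦ C.basis.constr ℤ (q v)
  -- Every property of `B` follows from that of `K` by cancelling `d i₀ ≠ 0`.
  have hB (x y) : K x y = d i₀ * B x y := by
    suffices K = d i₀ • B by rw [this]; rfl
    refine C.basis.ext fun v ↦ C.basis.ext fun w ↦ ?_
    simp [B, hq]
  refine ⟨B, ?_, ?_, ?_, ?_, ?_, ?_⟩
  · intro x y z
    apply mul_left_cancel₀ hm
    rw [mul_neg, ← hB, ← hB]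
    exact traceForm_lie x y z
  · exact fun i j ↦ mul_left_cancel₀ hm (by rw [← hB, hhh])
  · exact fun i β ↦ mul_left_cancel₀ hm (by rw [← hB, hhe, mul_zero])
  · exact fun i β ↦ mul_left_cancel₀ hm (by rw [← hB, heh, mul_zero])
  · intro α
    obtain ⟨i, hi⟩ := hneg α
    exact ⟨i, mul_left_cancel₀ hm (by rw [← hB, hi])⟩
  · exact fun α β h ↦ mul_left_cancel₀ hm (by rw [← hB, hee α β h, mul_zero])

variable (k) in
/-- The coordinates of an element of `𝔤` in the Chevalley basis. -/
noncomputable def coord (v : b.support ⊕ ι) : Module.Dual k (C.LieAlg k) :=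
  (C.basis.baseChange k).coord v

lemma eq_sum_coord [Fintype ι] (x : C.LieAlg k) :
    x = ∑ i, C.coord k (.inl i) x • C.h k i + ∑ α, C.coord k (.inr α) x • C.e k α := by
  have := ((C.basis.baseChange k).sum_repr x).symm
  simp only [Fintype.sum_sum_type, Module.Basis.baseChange_apply] at this
  exact this

lemma coord_ext {x y : C.LieAlg k} (h : ∀ v, C.coord k v x = C.coord k v y) : x = y :=
  (C.basis.baseChange k).ext_elem h

/-! ### Non-degeneracy, orthogonality of 𝔟 and 𝔫, and the identification of 𝔤 with 𝔤*. -/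

namespace IsNormalizedForm

variable {C} {c : b.support → ℤ} {B : LinearMap.BilinForm ℤ L}

lemma baseChange_apply_e (hB : C.IsNormalizedForm c B) (x : C.LieAlg k) (α : ι) :
    B.baseChange k x (C.e k (P.reflectionPerm α α)) = C.coord k (.inr α) x *
      (B (C.basis (.inr α)) (C.basis (.inr (P.reflectionPerm α α))) : k) := by
  have := Fintype.ofFinite ι
  classical
  conv_lhs => rw [C.eq_sum_coord x]
  simp only [map_add, map_sum, map_smul, LinearMap.add_apply, LinearMap.sum_apply,
    LinearMap.smul_apply, h, e, LinearMap.BilinForm.baseChange_tmul, hB.h_e, mul_one, zero_smul,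
    smul_zero, Finset.sum_const_zero, zero_add]
  rw [Finset.sum_eq_single α]
  · simp [← Int.cast_smul_eq_zsmul k]
  · intro β _ hβ
    rw [hB.e_e, zero_smul, smul_zero]
    intro h
    apply hβ
    apply P.root.injective
    have := congrArg P.root h
    rwa [root_reflectionPerm_self, root_reflectionPerm_self, neg_inj, eq_comm] at this
  · simp

lemma baseChange_apply_h (hB : C.IsNormalizedForm c B) (x : C.LieAlg k) (j : b.support) :
    B.baseChange k x (C.h k j) =
      ∑ i, C.coord k (.inl i) x * c i * (b.cartanMatrix i j : k) := by
  have := Fintype.ofFinite ι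
  conv_lhs => rw [C.eq_sum_coord x]
  simp only [map_add, map_sum, map_smul, LinearMap.add_apply, LinearMap.sum_apply,
    LinearMap.smul_apply, h, e, LinearMap.BilinForm.baseChange_tmul, hB.e_h, mul_one, zero_smul,
    smul_zero, Finset.sum_const_zero, add_zero, hB.h_h]
  refine Finset.sum_congr rfl fun i _ ↦ ?_
  rw [← Int.cast_smul_eq_zsmul k]
  push_cast
  simp only [smul_eq_mul]
  ring

lemma coord_e_eq_zero (hB : C.IsNormalizedForm c B) (hc : ∀ i, (c i : k) ≠ 0) {x : C.LieAlg k}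
    {α : ι} (h : B.baseChange k x (C.e k (P.reflectionPerm α α)) = 0) :
    C.coord k (.inr α) x = 0 := by
  rw [hB.baseChange_apply_e] at h
  obtain ⟨i, hi⟩ := hB.e_neg α
  rw [hi] at h
  exact (mul_eq_zero.mp h).resolve_right (hc i)

/-- The Cartan coordinates, scaled by the `c i`, form a row vector killed by the Cartan matrix,
which is invertible over `k`. -/
lemma coord_h_eq_zero [DecidableEq b.support] (hB : C.IsNormalizedForm c B) (hc : ∀ i, (c i : k) ≠ 0)
    (hdet : (b.cartanMatrix.det : k) ≠ 0) {x : C.LieAlg k}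
    (h : ∀ j, B.baseChange k x (C.h k j) = 0) (i : b.support) : C.coord k (.inl i) x = 0 := by
  have hv : Matrix.vecMul (fun i ↦ C.coord k (.inl i) x * c i)
      (b.cartanMatrix.map (Int.cast : ℤ → k)) = 0 := by
    ext j
    simpa [Matrix.vecMul, dotProduct, hB.baseChange_apply_h] using h j
  have := Matrix.eq_zero_of_vecMul_eq_zero (by
    have := RingHom.map_det (Int.castRingHom k) b.cartanMatrix
    rw [RingHom.mapMatrix_apply] at this
    exact this ▸ hdet) hv
  exact (mul_eq_zero.mp (congrFun this i)).resolve_right (hc i)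

lemma coord_e_of_forall_nilradical (hB : C.IsNormalizedForm c B) (hc : ∀ i, (c i : k) ≠ 0)
    {x : C.LieAlg k} (h : ∀ y ∈ C.nilradical k, B.baseChange k x y = 0) {α : ι}
    (hα : ¬ b.IsPos α) : C.coord k (.inr α) x = 0 :=
  hB.coord_e_eq_zero hc <| h _ <| Submodule.subset_span ⟨_, by
    have := P.indexNeg
    exact (Base.IsPos.neg_iff_not b α).mpr hα, rfl⟩

lemma nondegenerate [DecidableEq b.support] (hB : C.IsNormalizedForm c B) (hc : ∀ i, (c i : k) ≠ 0)
    (hdet : (b.cartanMatrix.det : k) ≠ 0) : (B.baseChange k).Nondegenerate := by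
  have : Module.Finite ℤ L := Module.Finite.of_basis C.basis
  rw [LinearMap.BilinForm.nondegenerate_iff_ker_eq_bot, LinearMap.ker_eq_bot']
  intro x hx
  refine C.coord_ext fun v ↦ ?_
  rw [map_zero]
  rcases v with i | α
  · exact hB.coord_h_eq_zero hc hdet (fun j ↦ by rw [hx, LinearMap.zero_apply]) i
  · exact hB.coord_e_eq_zero hc (by rw [hx, LinearMap.zero_apply])

lemma baseChange_h_e (hB : C.IsNormalizedForm c B) (i : b.support) (β : ι) :
    B.baseChange k (C.h k i) (C.e k β) = 0 := by
  simp [h, e, hB.h_e]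

lemma baseChange_e_h (hB : C.IsNormalizedForm c B) (i : b.support) (β : ι) :
    B.baseChange k (C.e k β) (C.h k i) = 0 := by
  simp [h, e, hB.e_h]

lemma baseChange_e_e (hB : C.IsNormalizedForm c B) {α β : ι} (hα : b.IsPos α) (hβ : b.IsPos β) :
    B.baseChange k (C.e k α) (C.e k β) = 0 := by
  have : β ≠ P.reflectionPerm α α := by
    rintro rfl
    exact (Base.IsPos.neg_iff_not b α).mp hβ hα
  simp [e, hB.e_e _ _ this]

lemma apply_borel_nilradical (hB : C.IsNormalizedForm c B) {x y : C.LieAlg k}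
    (hx : x ∈ C.borel k) (hy : y ∈ C.nilradical k) : B.baseChange k x y = 0 := by
  suffices C.borel k ≤ LinearMap.ker ((B.baseChange k).flip y) from this hx
  suffices C.nilradical k ≤
      ⨅ x ∈ Set.range (C.h k) ∪ {x | ∃ α, b.IsPos α ∧ x = C.e k α}, LinearMap.ker (B.baseChange k x) by
    have hy' := this hy
    simp only [Submodule.mem_iInf, LinearMap.mem_ker] at hy'
    rw [borel, nilradical, ← Submodule.span_union, Submodule.span_le]
    exact fun x hx ↦ hy' x hx
  rw [nilradical, Submodule.span_le]
  rintro - ⟨β, hβ, rfl⟩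
  simp only [SetLike.mem_coe, Submodule.mem_iInf, LinearMap.mem_ker]
  rintro - (⟨i, rfl⟩ | ⟨α, hα, rfl⟩)
  · exact hB.baseChange_h_e i β
  · exact hB.baseChange_e_e hα hβ

/-- The mirror image is proved separately because symmetry is not part of `IsNormalizedForm`. -/
lemma apply_nilradical_borel (hB : C.IsNormalizedForm c B) {x y : C.LieAlg k}
    (hx : x ∈ C.nilradical k) (hy : y ∈ C.borel k) : B.baseChange k x y = 0 := by
  suffices C.nilradical k ≤ LinearMap.ker ((B.baseChange k).flip y) from this hx
  suffices C.borel k ≤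
      ⨅ x ∈ {x | ∃ α, b.IsPos α ∧ x = C.e k α}, LinearMap.ker (B.baseChange k x) by
    have hy' := this hy
    simp only [Submodule.mem_iInf, LinearMap.mem_ker] at hy'
    rw [nilradical, Submodule.span_le]
    exact fun x hx ↦ hy' x hx
  rw [borel, nilradical, ← Submodule.span_union, Submodule.span_le]
  intro y hy
  simp only [SetLike.mem_coe, Submodule.mem_iInf, LinearMap.mem_ker]
  rintro - ⟨α, hα, rfl⟩
  obtain ⟨i, rfl⟩ | ⟨β, hβ, rfl⟩ := hy
  · exact hB.baseChange_e_h i α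
  · exact hB.baseChange_e_e hα hβ

lemma mem_borel_of_forall (hB : C.IsNormalizedForm c B) (hc : ∀ i, (c i : k) ≠ 0)
    {x : C.LieAlg k} (h : ∀ y ∈ C.nilradical k, B.baseChange k x y = 0) : x ∈ C.borel k := by
  have := Fintype.ofFinite ι
  rw [C.eq_sum_coord x]
  refine add_mem ?_ ?_
  · exact sum_mem fun i _ ↦ Submodule.smul_mem _ _
      (Submodule.mem_sup_left (Submodule.subset_span ⟨i, rfl⟩))
  · refine sum_mem fun α _ ↦ ?_
    by_cases hα : b.IsPos α
    · exact Submodule.smul_mem _ _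
        (Submodule.mem_sup_right (Submodule.subset_span ⟨α, hα, rfl⟩))
    · rw [hB.coord_e_of_forall_nilradical hc h hα, zero_smul]
      exact zero_mem _

lemma mem_nilradical_of_forall [DecidableEq b.support] (hB : C.IsNormalizedForm c B) (hc : ∀ i, (c i : k) ≠ 0)
    (hdet : (b.cartanMatrix.det : k) ≠ 0) {x : C.LieAlg k}
    (h : ∀ y ∈ C.borel k, B.baseChange k x y = 0) : x ∈ C.nilradical k := by
  have := Fintype.ofFinite ι
  rw [C.eq_sum_coord x]
  refine add_mem ?_ ?_
  · refine sum_mem fun i _ ↦ ?_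
    rw [hB.coord_h_eq_zero hc hdet (fun j ↦ h _
      (Submodule.mem_sup_left (Submodule.subset_span ⟨j, rfl⟩))), zero_smul]
    exact zero_mem _
  · refine sum_mem fun α _ ↦ ?_
    by_cases hα : b.IsPos α
    · exact Submodule.smul_mem _ _ (Submodule.subset_span ⟨α, hα, rfl⟩)
    · rw [hB.coord_e_of_forall_nilradical hc (fun y hy ↦ h y (Submodule.mem_sup_right hy)) hα,
        zero_smul]
      exact zero_mem _

theorem exists_identifiesSpringerData [DecidableEq b.support] (hB : C.IsNormalizedForm c B) (hc : ∀ i, (c i : k) ≠ 0)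
    (hdet : (b.cartanMatrix.det : k) ≠ 0) : ∃ κ, C.IdentifiesSpringerData k κ := by
  have : Module.Finite ℤ L := Module.Finite.of_basis C.basis
  let κ := (B.baseChange k).toDual (hB.nondegenerate hc hdet)
  have hκ (x y) : κ x y = B.baseChange k x y := LinearMap.BilinForm.toDual_def _
  have hinv := C.isInvariant_baseChange (k := k) B hB.lie_left
  refine ⟨κ, ?_, ?_, ?_, ?_⟩
  · intro g hg x
    refine LinearMap.ext fun y ↦ ?_
    have hy : y = g (g⁻¹ y) := by rw [← LinearEquiv.mul_apply, mul_inv_cancel]; rfl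
    rw [hκ, hy, hinv g hg, ← hy]
    exact (hκ x _).symm
  · ext ξ
    obtain ⟨x, rfl⟩ := κ.surjective ξ
    rw [Submodule.mem_map_equiv, LinearEquiv.symm_apply_apply, borelDual,
      Submodule.mem_dualAnnihilator]
    exact ⟨fun hx y hy ↦ (hκ x y).trans (hB.apply_borel_nilradical hx hy),
      fun h ↦ hB.mem_borel_of_forall hc fun y hy ↦ (hκ x y).symm.trans (h y hy)⟩
  · ext ξ
    obtain ⟨x, rfl⟩ := κ.surjective ξ
    rw [Submodule.mem_map_equiv, LinearEquiv.symm_apply_apply, nilradicalDual,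
      Submodule.mem_dualAnnihilator]
    exact ⟨fun hx y hy ↦ (hκ x y).trans (hB.apply_nilradical_borel hx hy),
      fun h ↦ hB.mem_nilradical_of_forall hc hdet fun y hy ↦ (hκ x y).symm.trans (h y hy)⟩
  · ext ξ
    constructor
    · rintro ⟨-, ⟨g, hg, y, hy, rfl⟩, rfl⟩
      exact ⟨g, hg, fun z hz ↦ by rw [hκ, hinv g hg, hB.apply_nilradical_borel hy hz]⟩
    · rintro ⟨g, hg, h⟩
      obtain ⟨x, rfl⟩ := κ.surjective ξ
      have hx : x = g (g⁻¹ x) := by rw [← LinearEquiv.mul_apply, mul_inv_cancel]; rfl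
      -- By invariance B(x, ·) kills g𝔟 exactly when g⁻¹x is orthogonal to 𝔟, that is, when g⁻¹x
      -- lies in 𝔫.
      refine ⟨x, ⟨g, hg, g⁻¹ x, hB.mem_nilradical_of_forall hc hdet fun y hy ↦ ?_, hx⟩, rfl⟩
      rw [← hinv g hg, ← hx, ← hκ, h y hy]

end IsNormalizedForm

end ChevalleyBasis

/-! ### Specialization to the Cartan matrices of G₂ and F₄. -/

/-- The lemma for a root system with unimodular Cartan matrix whose symmetrization is given by `c`,
where the ratio of the squared root lengths is the prime number `p`. -/
theorem ChevalleyBasis.springer_of_cartanMatrix {k : Type*} [Field k] [Infinite k]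
    {ι M N : Type*} [Finite ι] [AddCommGroup M] [Module ℚ M] [AddCommGroup N] [Module ℚ N]
    (P : RootPairing ι ℚ M N) [P.IsRootSystem] [P.IsCrystallographic] [P.IsReduced] (b : P.Base)
    {L : Type*} [LieRing L] (C : ChevalleyBasis P b L) {n : ℕ} {A : Matrix (Fin n) (Fin n) ℤ}
    (hA : HasCartanType b A) (p : ℕ) [hp : Fact p.Prime] (l s : Fin n)
    (hls : A l s = -p) (hsl : A s l = -1) (hdet : A.det = 1)
    (hrow : ∀ i, ∃ j, ¬ (p : ℤ) ∣ A i j) (c : Fin n → ℤ) (hc : ∀ i, c i ∣ p)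
    (hAc : ∀ d : Fin n → ℤ, (∀ i j, A i j * d i = A j i * d j) → ∀ i, d i = c i * d l) :
    ((∃ B : LinearMap.BilinForm k (C.LieAlg k), C.IsInvariant k B ∧ B.Nondegenerate) ↔
      ringChar k ≠ p) ∧ (ringChar k ≠ p → ∃ κ, C.IdentifiesSpringerData k κ) := by
  classical
  obtain ⟨f, hf⟩ := hA
  have hAf (i j) : A i j = b.cartanMatrix (f.symm i) (f.symm j) := by rw [hf]; simp
  have hdet' : b.cartanMatrix.det = 1 := by
    rw [← hdet, ← Matrix.det_submatrix_equiv_self f A]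
    congr 1
    ext i j
    exact hf i j
  obtain ⟨B, hB⟩ := C.exists_isNormalizedForm (fun i ↦ c (f i)) (f.symm l) fun d hd i ↦ by
    simpa using hAc (d ∘ f.symm) (fun i j ↦ by simpa [hAf] using hd (f.symm i) (f.symm j)) (f i)
  have hpk (h : ringChar k ≠ p) : (p : k) ≠ 0 := by
    rw [Ne, ringChar.spec, Nat.dvd_prime hp.out]
    rintro (h1 | h1)
    · exact CharP.ringChar_ne_one h1
    · exact h h1
  have hck (h : ringChar k ≠ p) (i : b.support) : (c (f i) : k) ≠ 0 := by
    intro h0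
    obtain ⟨q, hq⟩ := hc (f i)
    apply hpk h
    rw [← Int.cast_natCast, hq, Int.cast_mul, h0, zero_mul]
  have hdk : (b.cartanMatrix.det : k) ≠ 0 := by simp [hdet']
  refine ⟨⟨?_, fun h ↦ ⟨B.baseChange k, C.isInvariant_baseChange B hB.lie_left,
    hB.nondegenerate (hck h) hdk⟩⟩, fun h ↦ hB.exists_identifiesSpringerData (hck h) hdk⟩
  rintro ⟨B, hinv, hnd⟩ hchar
  have hp0 : (p : k) = 0 := by rw [ringChar.spec, hchar]
  refine C.not_nondegenerate_of_isInvariant (f.symm l) (f.symm s) ?_ ?_ (fun i ↦ ?_) hinv hnd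
  · rw [← hAf, hls]; simp [hp0]
  · rw [← hAf, hsl]; simp
  · obtain ⟨j, hj⟩ := hrow (f i)
    refine ⟨f.symm j, ?_⟩
    rw [hf, Equiv.apply_symm_apply]
    have : CharP k p := ringChar.of_eq hchar
    rwa [Ne, CharP.intCast_eq_zero_iff k p]

theorem lemma2p1 {k : Type*} [Field k] [IsAlgClosed k]
    {ι M N : Type*} [Finite ι] [AddCommGroup M] [Module ℚ M] [AddCommGroup N] [Module ℚ N]
    (P : RootPairing ι ℚ M N) [P.IsRootSystem] [P.IsCrystallographic] [P.IsReduced] (b : P.Base)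
    {L : Type*} [LieRing L] (C : ChevalleyBasis P b L) :
    (HasCartanType b CartanMatrix.G₂ →
      ((∃ B : LinearMap.BilinForm k (C.LieAlg k), C.IsInvariant k B ∧ B.Nondegenerate) ↔
        ringChar k ≠ 3) ∧
      (ringChar k ≠ 3 → ∃ κ, C.IdentifiesSpringerData k κ)) ∧
    (HasCartanType b CartanMatrix.F₄ →
      ((∃ B : LinearMap.BilinForm k (C.LieAlg k), C.IsInvariant k B ∧ B.Nondegenerate) ↔
        ringChar k ≠ 2) ∧
      (ringChar k ≠ 2 → ∃ κ, C.IdentifiesSpringerData k κ)) := by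
  have : Infinite k := IsAlgClosed.instInfinite
  refine ⟨fun h ↦ ?_, fun h ↦ ?_⟩
  · have : Fact (Nat.Prime 3) := ⟨Nat.prime_three⟩
    -- Root 0 is long and root 1 short, so d₁ = 3d₀. The column 0 contains 2 and -1, both prime to
    -- 3.
    refine C.springer_of_cartanMatrix P b h 3 0 1 (by decide) (by decide) CartanMatrix.G₂_det
      (fun i ↦ ⟨![0, 0] i, by revert i; decide⟩) ![1, 3] (by decide) fun d hd i ↦ ?_
    have h01 := hd 0 1
    simp [CartanMatrix.G₂] at h01
    fin_cases i <;> (simp <;> omega)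
  · have : Fact (Nat.Prime 2) := ⟨Nat.prime_two⟩
    -- Roots 0, 1 are long and 2, 3 short. The diagonal entries 2 vanish modulo 2, so in each row a
    -- neighbour with entry -1 is chosen.
    refine C.springer_of_cartanMatrix P b h 2 1 2 (by decide) (by decide) CartanMatrix.F₄_det
      (fun i ↦ ⟨![1, 0, 1, 2] i, by revert i; decide⟩) ![1, 1, 2, 2] (by decide) fun d hd i ↦ ?_
    have h01 := hd 0 1
    have h12 := hd 1 2
    have h23 := hd 2 3
    simp [CartanMatrix.F₄] at h01 h12 h23
    fin_cases i <;> (simp <;> omega)
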